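/- Let $\mathcal{H}$ be a separable complex Hilbert space. For a compact operator $K$ on $\mathcal{H}$ let $s_1(K)\ge s_2(K)\ge\cdots$ be its non-zero singular values (the square roots of the non-zero eigenvalues of $K^*K$, counted with multiplicity). For real $p\ge 1$ put $\|K\|_p:=\big(\sum_k s_k(K)^p\big)^{1/p}$, with $\|K\|_p:=\infty$ for bounded non-compact $K$, and let $\mathcal{L}^p$ be the set of compact operators $K$ with $\|K\|_p<\infty$. Let $\{U(t)\}_{t\ge 0}$ be a $C_0$-semigroup of bounded operators on $\mathcal{H}$ with generator $A$, written $U(t)=e^{-tA}$, that is, $$Ax=\lim_{t\downarrow 0}\tfrac1t\,(x-U(t)x),$$ with domain the set of those $x\in\mathcal{H}$ for which this limit exists. Let $\rho(A)$ be the resolvent set of $A$ and $R_A(z):=(A-z)^{-1}$ for $z\in\rho(A)$. Suppose that for some real $q\ge 1$: 1. $t\mapsto U(t)$ is $\|\cdot\|_q$-continuous on $(0,\infty)$, that is, $\lim_{\tau\to t}\|U(\tau)-U(t)\|_q=0$ for every $t>0$ (it is not assumed that $U(t)\in\mathcal{L}^q$); 2. $0\in\rho(A)$, and $R_A(z)\in\mathcal{L}^q$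 for some $z\in\rho(A)$. Then $\{U(t)\}_{t\ge 0}$ is a Gibbs semigroup, that is, $U(t)\in\mathcal{L}^1$ for every $t>0$. -/

import Mathlib

open Filter Topology
open scoped ENNReal

noncomputable section

namespace GibbsSemigroup

variable {H : Type*} [NormedAddCommGroup H] [InnerProductSpace ℂ H]

/-- A `C₀`-semigroup `{U(t)}_{t ≥ 0}` of bounded operators, strongly continuous at `t = +0`.
The values `U t` for `t < 0` play no role. -/
structure IsC0Semigroup (U : ℝ → H →L[ℂ] H) : Prop where
  map_zero : U 0 = 1
  map_add : ∀ s t : ℝ, 0 ≤ s → 0 ≤ t → U (s + t) = U s * U t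
  tendsto_zero : ∀ x : H, Tendsto (fun t => U t x) (𝓝[>] 0) (𝓝 x)

/-- The graph of the generator `A` of `U(t) = e^{-tA}`, with the sign convention
`A x = lim_{t ↓ 0} t⁻¹ (x - U(t) x)`. -/
def generatorGraph (U : ℝ → H →L[ℂ] H) : Submodule ℂ (H × H) where
  carrier := {p | Tendsto (fun t : ℝ => (t : ℂ)⁻¹ • (p.1 - U t p.1)) (𝓝[>] 0) (𝓝 p.2)}
  zero_mem' := by simp
  add_mem' := by
    intro a b ha hb
    have h := Tendsto.add ha hb
    refine Tendsto.congr (fun t => ?_) h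
    simp only [Prod.fst_add, map_add, ← smul_add]
    congr 1
    abel
  smul_mem' := by
    intro c a ha
    have h := Tendsto.const_smul ha c
    refine Tendsto.congr (fun t => ?_) h
    simp only [Prod.smul_fst, map_smul, ← smul_sub]
    rw [smul_comm]

/-- The generator `A` of `U(t) = e^{-tA}`: its domain consists of the `x` for which
`lim_{t ↓ 0} t⁻¹ (x - U(t) x)` exists, and `A x` is this limit. -/
def generator (U : ℝ → H →L[ℂ] H) : H →ₗ.[ℂ] H := (generatorGraph U).toLinearPMap

theorem mem_generator_graph_iff (U : ℝ → H →L[ℂ] H) (x y : H) :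
    (x, y) ∈ (generator U).graph ↔
      Tendsto (fun t : ℝ => (t : ℂ)⁻¹ • (x - U t x)) (𝓝[>] 0) (𝓝 y) := by
  have h : (generator U).graph = generatorGraph U := by
    refine Submodule.toLinearPMap_graph_eq _ ?_
    intro p hp h0
    have h1 : Tendsto (fun t : ℝ => (t : ℂ)⁻¹ • (p.1 - U t p.1)) (𝓝[>] 0) (𝓝 p.2) := hp
    simp only [h0, map_zero, sub_zero, smul_zero] at h1
    exact tendsto_nhds_unique h1 tendsto_const_nhds
  rw [h]
  rfl

/-- `R` is a bounded, everywhere defined, two-sided inverse of `A - z : dom A → H`. -/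
def IsResolventAt (A : H →ₗ.[ℂ] H) (z : ℂ) (R : H →L[ℂ] H) : Prop :=
  (∀ y : H, ∃ h : R y ∈ A.domain, A ⟨R y, h⟩ - z • R y = y) ∧
    ∀ x : A.domain, R (A x - z • (x : H)) = x

/-- The resolvent set `ρ(A)`. -/
def resolventSet (A : H →ₗ.[ℂ] H) : Set ℂ := {z | ∃ R : H →L[ℂ] H, IsResolventAt A z R}

open Classical in
/-- The resolvent `R_A(z) = (A - z)⁻¹` for `z ∈ ρ(A)` (and `0` for other `z`). -/
def resolvent (A : H →ₗ.[ℂ] H) (z : ℂ) : H →L[ℂ] H :=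
  if h : ∃ R : H →L[ℂ] H, IsResolventAt A z R then h.choose else 0

theorem isResolventAt_resolvent {A : H →ₗ.[ℂ] H} {z : ℂ} (hz : z ∈ resolventSet A) :
    IsResolventAt A z (resolvent A z) := by
  have h : ∃ R : H →L[ℂ] H, IsResolventAt A z R := hz
  rw [resolvent, dif_pos h]
  exact h.choose_spec

variable [CompleteSpace H]

/-- The multiplicity of `s > 0` as a singular value of a compact operator `K`, that is, the
multiplicity of `s ^ 2` as an eigenvalue of `K* K`. -/
def singularMultiplicity (K : H →L[ℂ] H) (s : ℝ) : ℕ :=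
  Module.finrank ℂ (Module.End.eigenspace
    ((ContinuousLinearMap.adjoint K * K : H →L[ℂ] H) : H →ₗ[ℂ] H) ((s : ℂ) ^ 2))

open Classical in
/-- The Schatten norm `‖K‖_p = (∑ s_k(K) ^ p) ^ (1 / p)`, where `s_k(K)` runs over the nonzero
singular values of the compact operator `K`, each repeated according to its multiplicity.
It is `∞` if the sum diverges, and if `K` is not compact. -/
def schattenNorm (p : ℝ) (K : H →L[ℂ] H) : ℝ≥0∞ :=
  if IsCompactOperator K then
    (∑' s : Set.Ioi (0 : ℝ),
      (singularMultiplicity K s : ℝ≥0∞) * ENNReal.ofReal (s : ℝ) ^ p) ^ (1 / p)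
  else ⊤

/-- The von Neumann-Schatten class `𝓛^p`. -/
def schattenClass (H : Type*) [NormedAddCommGroup H] [InnerProductSpace ℂ H] [CompleteSpace H]
    (p : ℝ) : Set (H →L[ℂ] H) :=
  {K | IsCompactOperator K ∧ schattenNorm p K < ⊤}

/-- `‖·‖_q`-continuity of `U` on `(0, ∞)`: for every `t > 0`, `‖U(τ) - U(t)‖_q → 0` as `τ → t`.
The operators `U(t)` themselves are not required to lie in `𝓛^q`. -/
def IsSchattenContinuous (q : ℝ) (U : ℝ → H →L[ℂ] H) : Prop :=
  ∀ t : ℝ, 0 < t → Tendsto (fun τ => schattenNorm q (U τ - U t)) (𝓝 t) (𝓝 0)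

/-- An (immediately) Gibbs semigroup: a `C₀`-semigroup with `U(t) ∈ 𝓛^1` for `t > 0`. -/
def IsGibbsSemigroup (U : ℝ → H →L[ℂ] H) : Prop :=
  IsC0Semigroup U ∧ ∀ t : ℝ, 0 < t → U t ∈ schattenClass H 1

end GibbsSemigroup

end

/-! Schatten continuity implies operator-norm continuity on `(0, ∞)`, so the norm integral of `U`
over `[t, t + e]` exists for `t, e > 0`; it equals `R (U t - U (t + e))` with `R = A⁻¹`. By the
resolvent identity `R` is compact, so these integrals are compact, and so is their normalised limit
`U t` as `e ↓ 0`.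

Compactness is then upgraded. Choose `e > 0` with `U (t + e) - U t` in the Schatten class and `F` of
finite rank with `‖U e - F‖ ≤ 1/2`. Then `U t (1 - (U e - F)) = U t F - (U (t + e) - U t)`, and the
factor `1 - (U e - F)` is invertible, so `U t` inherits the approximability of the right-hand side
(`IsC0Semigroup.hasFiniteRankApprox`).

This is measured in the weak class `HasFiniteRankApprox q`, whose closure properties come from
explicit approximants. Powers divide the exponent, so `U t = U (t / n) ^ n` has exponent `q / n < 1`
once `n > q`. The slack below `1` makes the weak bound summable. -/

namespace GibbsSemigroup

/-! ### Weak Schatten classes through finite-rank approximation. -/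

section FiniteRankApproximation

variable {H : Type*} [NormedAddCommGroup H] [InnerProductSpace ℂ H]

/-- `K` is approximated within `ε` by operators of rank `O(ε ^ (-p))` as `ε → 0`; this is the
weak Schatten class of exponent `p`, described through approximation numbers. -/
def HasFiniteRankApprox (p : ℝ) (K : H →L[ℂ] H) : Prop :=
  ∃ C : ℝ, ∀ ε : ℝ, 0 < ε → ε ≤ 1 → ∃ F : H →L[ℂ] H, ‖K - F‖ ≤ ε ∧
    ∃ k : ℕ, (F : H →ₗ[ℂ] H).rank ≤ (k : Cardinal) ∧ (k : ℝ) ≤ C * ε ^ (-p)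

theorem hasFiniteRankApprox_of_rank_le {p : ℝ} (hp : 0 ≤ p) {F : H →L[ℂ] H} {k : ℕ}
    (hF : (F : H →ₗ[ℂ] H).rank ≤ (k : Cardinal)) : HasFiniteRankApprox p F := by
  refine ⟨k, fun ε hε hε1 => ⟨F, by simpa using hε.le, k, hF, ?_⟩⟩
  have h : 1 ≤ ε ^ (-p) := Real.one_le_rpow_of_pos_of_le_one_of_nonpos hε hε1 (by linarith)
  nlinarith [Nat.cast_nonneg (α := ℝ) k]

theorem HasFiniteRankApprox.sub {p : ℝ} {K L : H →L[ℂ] H}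
    (hK : HasFiniteRankApprox p K) (hL : HasFiniteRankApprox p L) :
    HasFiniteRankApprox p (K - L) := by
  obtain ⟨C, hC⟩ := hK
  obtain ⟨D, hD⟩ := hL
  refine ⟨(C + D) * 2⁻¹ ^ (-p), fun ε hε hε1 => ?_⟩
  obtain ⟨F, hF, k, hFk, hk⟩ := hC (2⁻¹ * ε) (by positivity) (by linarith)
  obtain ⟨G, hG, l, hGl, hl⟩ := hD (2⁻¹ * ε) (by positivity) (by linarith)
  refine ⟨F - G, ?_, k + l, ?_, ?_⟩
  · calc ‖K - L - (F - G)‖ = ‖(K - F) - (L - G)‖ := by congr 1; abel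
      _ ≤ ‖K - F‖ + ‖L - G‖ := norm_sub_le _ _
      _ ≤ ε := by linarith
  · have h1 : ((F - G : H →L[ℂ] H) : H →ₗ[ℂ] H)
        = (F : H →ₗ[ℂ] H) + (-LinearMap.id).comp (G : H →ₗ[ℂ] H) := by
      ext x; simp [sub_eq_add_neg]
    rw [h1]
    refine (LinearMap.rank_add_le _ _).trans ?_
    push_cast
    exact add_le_add hFk ((LinearMap.rank_comp_le_right _ _).trans hGl)
  · rw [Real.mul_rpow (by norm_num) hε.le] at hk hl
    push_cast
    linarith

theorem HasFiniteRankApprox.mul_right {p : ℝ} {K : H →L[ℂ] H}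
    (hK : HasFiniteRankApprox p K) (B : H →L[ℂ] H) : HasFiniteRankApprox p (K * B) := by
  obtain ⟨C, hC⟩ := hK
  have hb : 0 < ‖B‖ + 1 := by positivity
  have hb1 : (‖B‖ + 1)⁻¹ ≤ 1 := inv_le_one_of_one_le₀ (by linarith [norm_nonneg B])
  have hb0 : 0 < (‖B‖ + 1)⁻¹ := by positivity
  refine ⟨C * (‖B‖ + 1)⁻¹ ^ (-p), fun ε hε hε1 => ?_⟩
  obtain ⟨F, hF, k, hFk, hk⟩ := hC ((‖B‖ + 1)⁻¹ * ε) (by positivity) (by nlinarith)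
  refine ⟨F * B, ?_, k, (LinearMap.rank_comp_le_left (B : H →ₗ[ℂ] H) (F : H →ₗ[ℂ] H)).trans hFk, ?_⟩
  · calc ‖K * B - F * B‖ = ‖(K - F) * B‖ := by rw [sub_mul]
      _ ≤ ‖K - F‖ * ‖B‖ := norm_mul_le _ _
      _ ≤ ((‖B‖ + 1)⁻¹ * ε) * (‖B‖ + 1) := by gcongr; linarith
      _ = ε := by field_simp
  · rw [Real.mul_rpow hb0.le hε.le] at hk
    linarith

/-- Telescoping: `K ^ (n + 1) - L ^ (n + 1) = (K ^ n - L ^ n) K + L ^ n (K - L)`, and each step adds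
rank at most `k`. -/
theorem rank_pow_sub_pow_le (K L : H →L[ℂ] H) {k : ℕ}
    (hk : ((K - L : H →L[ℂ] H) : H →ₗ[ℂ] H).rank ≤ (k : Cardinal)) (n : ℕ) :
    ((K ^ n - L ^ n : H →L[ℂ] H) : H →ₗ[ℂ] H).rank ≤ ((n * k : ℕ) : Cardinal) := by
  induction n with
  | zero => simp
  | succ n ih =>
    have h1 : ((K ^ (n + 1) - L ^ (n + 1) : H →L[ℂ] H) : H →ₗ[ℂ] H)
        = ((K ^ n - L ^ n : H →L[ℂ] H) : H →ₗ[ℂ] H).comp (K : H →ₗ[ℂ] H)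
          + ((L ^ n : H →L[ℂ] H) : H →ₗ[ℂ] H).comp ((K - L : H →L[ℂ] H) : H →ₗ[ℂ] H) := by
      ext x
      simp [pow_succ]
    rw [h1]
    refine (LinearMap.rank_add_le _ _).trans ?_
    rw [Nat.succ_mul, Nat.cast_add]
    exact add_le_add ((LinearMap.rank_comp_le_left _ _).trans ih)
      ((LinearMap.rank_comp_le_right _ _).trans hk)

/-- If `F` approximates `K` within `ε ^ (1 / n)`, then `K ^ n - (K - F) ^ n` approximates `K ^ n`
within `ε`, at only `n` times the rank. -/
theorem HasFiniteRankApprox.pow {p : ℝ} {K : H →L[ℂ] H}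
    (hK : HasFiniteRankApprox p K) {n : ℕ} (hn : n ≠ 0) :
    HasFiniteRankApprox (p / n) (K ^ n) := by
  obtain ⟨C, hC⟩ := hK
  refine ⟨n * C, fun ε hε hε1 => ?_⟩
  obtain ⟨F, hF, k, hFk, hk⟩ := hC (ε ^ ((n : ℝ)⁻¹)) (by positivity)
    (Real.rpow_le_one hε.le hε1 (by positivity))
  refine ⟨K ^ n - (K - F) ^ n, ?_, n * k, ?_, ?_⟩
  · rw [sub_sub_cancel]
    calc ‖(K - F) ^ n‖ ≤ ‖K - F‖ ^ n := norm_pow_le' _ (Nat.pos_of_ne_zero hn)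
      _ ≤ (ε ^ ((n : ℝ)⁻¹)) ^ n := by gcongr
      _ = ε := Real.rpow_inv_natCast_pow hε.le hn
  · exact rank_pow_sub_pow_le K (K - F) (by rwa [sub_sub_cancel]) n
  · rw [← Real.rpow_mul hε.le, show (n : ℝ)⁻¹ * -p = -(p / n) by ring] at hk
    push_cast
    rw [mul_assoc]
    gcongr

end FiniteRankApproximation

/-! ### Compact operators as limits of finite-rank ones. -/

section CompactApproximation

variable {H : Type*} [NormedAddCommGroup H] [InnerProductSpace ℂ H]

/-- A compact operator on a Hilbert space is a norm limit of operators of finite rank. -/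
theorem _root_.IsCompactOperator.exists_rank_le_norm_sub_le {K : H →L[ℂ] H}
    (hK : IsCompactOperator K) {δ : ℝ} (hδ : 0 < δ) :
    ∃ (F : H →L[ℂ] H) (k : ℕ), (F : H →ₗ[ℂ] H).rank ≤ (k : Cardinal) ∧ ‖K - F‖ ≤ δ := by
  obtain ⟨S, hS, hKS⟩ := hK.image_closedBall_subset_compact (f := (K : H →ₗ[ℂ] H)) 1
  obtain ⟨t, -, htf, hSt⟩ := hS.finite_cover_balls hδ
  let V : Submodule ℂ H := Submodule.span ℂ t
  have hV : FiniteDimensional ℂ V := FiniteDimensional.span_of_finite ℂ htf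
  refine ⟨V.starProjection * K, Module.finrank ℂ V, ?_, ?_⟩
  · refine (LinearMap.rank_comp_le_left (K : H →ₗ[ℂ] H) (V.starProjection : H →ₗ[ℂ] H)).trans ?_
    rw [Module.finrank_eq_rank]
    refine Submodule.rank_mono ?_
    rintro _ ⟨x, rfl⟩
    exact V.starProjection_apply_mem x
  · refine ContinuousLinearMap.opNorm_le_of_unit_norm hδ.le fun x hx => ?_
    have hx' : K x ∈ S := hKS ⟨x, by simp [hx], rfl⟩
    obtain ⟨y, hy, hxy⟩ := Set.mem_iUnion₂.1 (hSt hx')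
    have hle : ‖K x - V.starProjection (K x)‖ ≤ ‖K x - y‖ := by
      rw [V.starProjection_minimal (K x)]
      exact ciInf_le ⟨0, by rintro _ ⟨v, rfl⟩; exact norm_nonneg _⟩
        (⟨y, Submodule.subset_span hy⟩ : V)
    exact hle.trans (by rw [← dist_eq_norm]; exact (Metric.mem_ball.1 hxy).le)

end CompactApproximation

/-! ### Eigenspaces of `K* K` and counting singular values. -/

section SingularSpaces

variable {H : Type*} [NormedAddCommGroup H] [InnerProductSpace ℂ H] [CompleteSpace H]

/-- The eigenspace of `K* K` for the eigenvalue `s ^ 2`. -/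
noncomputable def singularSpace (K : H →L[ℂ] H) (s : ℝ) : Submodule ℂ H :=
  Module.End.eigenspace
    ((ContinuousLinearMap.adjoint K * K : H →L[ℂ] H) : H →ₗ[ℂ] H) ((s : ℂ) ^ 2)

theorem isSymmetric_adjoint_mul_self (K : H →L[ℂ] H) :
    ((ContinuousLinearMap.adjoint K * K : H →L[ℂ] H) : H →ₗ[ℂ] H).IsSymmetric := by
  intro x y
  simp [ContinuousLinearMap.adjoint_inner_left, ContinuousLinearMap.adjoint_inner_right]

theorem isCompactOperator_adjoint_mul_self {K : H →L[ℂ] H} (hK : IsCompactOperator K) :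
    IsCompactOperator (ContinuousLinearMap.adjoint K * K : H →L[ℂ] H) :=
  hK.clm_comp (ContinuousLinearMap.adjoint K)

theorem inner_adjoint_mul_self (K : H →L[ℂ] H) (x : H) :
    inner ℂ x ((ContinuousLinearMap.adjoint K * K : H →L[ℂ] H) x) = (‖K x‖ : ℂ) ^ 2 := by
  simp [ContinuousLinearMap.adjoint_inner_right, inner_self_eq_norm_sq_to_K]

theorem mem_singularSpace {K : H →L[ℂ] H} {s : ℝ} {x : H} :
    x ∈ singularSpace K s ↔
      (ContinuousLinearMap.adjoint K * K : H →L[ℂ] H) x = ((s : ℂ) ^ 2) • x :=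
  Module.End.mem_eigenspace_iff

theorem finiteDimensional_singularSpace {K : H →L[ℂ] H} (hK : IsCompactOperator K) {s : ℝ}
    (hs : 0 < s) : FiniteDimensional ℂ (singularSpace K s) :=
  ContinuousLinearMap.finite_dimensional_eigenspace (isCompactOperator_adjoint_mul_self hK) _
    (by exact_mod_cast (pow_pos hs 2).ne')

theorem orthogonalFamily_singularSpace (K : H →L[ℂ] H) {ι : Type*} (s : ι → ℝ)
    (hs : ∀ i, 0 < s i) (hinj : Function.Injective s) :
    OrthogonalFamily ℂ (fun i => singularSpace K (s i))
      fun i => (singularSpace K (s i)).subtypeₗᵢ :=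
  (isSymmetric_adjoint_mul_self K).orthogonalFamily_eigenspaces.comp
    (γ := ι) (f := fun i => ((s i : ℂ)) ^ 2) <| by
      intro i j hij
      have h : s i ^ 2 = s j ^ 2 := Complex.ofReal_injective (by simpa using hij)
      exact hinj ((sq_eq_sq₀ (hs i).le (hs j).le).1 h)

/-- If a submodule contains all singular spaces of a compact operator with singular value above
`ε`, the operator is bounded by `ε` on its orthogonal complement. -/
theorem norm_apply_le_of_singularSpace_le {K : H →L[ℂ] H} (hK : IsCompactOperator K) {ε : ℝ}
    (hε : 0 < ε) {V : Submodule ℂ H}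
    (hV : ∀ s : ℝ, ε ≤ s → singularSpace K s ≤ V)
    (hinv : ∀ v ∈ Vᗮ, (ContinuousLinearMap.adjoint K * K : H →L[ℂ] H) v ∈ Vᗮ)
    {y : H} (hy : y ∈ Vᗮ) : ‖K y‖ ≤ ε * ‖y‖ := by
  set T : H →L[ℂ] H := ContinuousLinearMap.adjoint K * K with hT
  let S : Vᗮ →L[ℂ] Vᗮ := T.restrict hinv
  have hS_compact : IsCompactOperator S :=
    (isCompactOperator_adjoint_mul_self hK).restrict' (f := (T : H →ₗ[ℂ] H)) hinv
  have hS_symm : (S : Vᗮ →ₗ[ℂ] Vᗮ).IsSymmetric :=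
    (isSymmetric_adjoint_mul_self K).restrict_invariant hinv
  -- The norm of the self-adjoint `S` is its spectral radius, and nonzero spectrum of a compact
  -- operator consists of eigenvalues. An eigenvalue `s ^ 2` with `s ≥ ε` would put its eigenvector
  -- in both `V` and `Vᗮ`.
  have hS : ‖S‖₊ ≤ (Real.toNNReal ε) ^ 2 := by
    rw [← ENNReal.coe_le_coe, ← S.spectralRadius_eq_nnnorm hS_symm.isSelfAdjoint, spectralRadius]
    refine iSup₂_le fun μ hμ => ?_
    rw [ENNReal.coe_le_coe]
    by_cases hμ0 : μ = 0
    · simp [hμ0]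
    have hev := (hS_compact.hasEigenvalue_iff_mem_spectrum hμ0).2 hμ
    obtain ⟨v, hv⟩ := hev.exists_hasEigenvector
    have hv0 : (v : H) ≠ 0 := by simpa using hv.2
    have hTv : T v = μ • (v : H) := congrArg Subtype.val hv.apply_eq_smul
    have hnorm : μ * (‖(v : H)‖ : ℂ) ^ 2 = (‖K v‖ : ℂ) ^ 2 := by
      rw [← inner_adjoint_mul_self K, ← hT, hTv, inner_smul_right, inner_self_eq_norm_sq_to_K]
      simp
    have hvn : 0 < ‖(v : H)‖ := norm_pos_iff.2 hv0
    have hμs : μ = ((‖K v‖ / ‖(v : H)‖ : ℝ) : ℂ) ^ 2 := by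
      have : (‖(v : H)‖ : ℂ) ≠ 0 := by exact_mod_cast hvn.ne'
      push_cast
      rw [div_pow, eq_div_iff (pow_ne_zero 2 this), hnorm]
    set s : ℝ := ‖K v‖ / ‖(v : H)‖ with hs
    have hs0 : 0 ≤ s := by positivity
    have hsε : s < ε := by
      by_contra! h
      have hmem : (v : H) ∈ V := hV s h (mem_singularSpace.2 (by rw [← hT, hTv, hμs]))
      exact hv0 (inner_self_eq_zero.1 (v.2 _ hmem) )
    rw [← NNReal.coe_le_coe]
    simp only [coe_nnnorm, NNReal.coe_pow, Real.coe_toNNReal _ hε.le]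
    rw [hμs, norm_pow, Complex.norm_real, Real.norm_of_nonneg hs0]
    gcongr
  have hS' : ‖S‖ ≤ ε ^ 2 := by
    have := NNReal.coe_le_coe.2 hS
    simpa [Real.coe_toNNReal _ hε.le] using this
  have h1 : ‖K y‖ ^ 2 ≤ (ε * ‖y‖) ^ 2 := by
    have h2 : ‖K y‖ ^ 2 = ‖inner ℂ y (T y)‖ := by
      rw [inner_adjoint_mul_self]; simp
    have h3 : ‖T y‖ ≤ ‖S‖ * ‖y‖ := S.le_opNorm ⟨y, hy⟩
    calc ‖K y‖ ^ 2 ≤ ‖y‖ * ‖T y‖ := h2 ▸ norm_inner_le_norm _ _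
      _ ≤ ‖y‖ * (ε ^ 2 * ‖y‖) := by gcongr; exact h3.trans (by gcongr)
      _ = (ε * ‖y‖) ^ 2 := by ring
  exact le_of_sq_le_sq h1 (by positivity)

/-- Truncated singular value decomposition: `F` is `K` composed with the projection onto the span of
the singular spaces indexed by `t`. -/
theorem exists_rank_le_norm_sub_le_of_singularSpace_eq_bot {K : H →L[ℂ] H}
    (hK : IsCompactOperator K) {ε : ℝ} (hε : 0 < ε) (t : Finset ℝ) (ht0 : ∀ s ∈ t, 0 < s)
    (ht : ∀ s, ε ≤ s → s ∉ t → singularSpace K s = ⊥) :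
    ∃ F : H →L[ℂ] H, ‖K - F‖ ≤ ε ∧
      (F : H →ₗ[ℂ] H).rank ≤ ((∑ s ∈ t, singularMultiplicity K s : ℕ) : Cardinal) := by
  let V : Submodule ℂ H := ⨆ s ∈ t, singularSpace K s
  have hfin : ∀ u : Finset ℝ, (∀ s ∈ u, 0 < s) →
      Module.rank ℂ (⨆ s ∈ u, singularSpace K s : Submodule ℂ H)
        ≤ ((∑ s ∈ u, singularMultiplicity K s : ℕ) : Cardinal) := by
    intro u
    induction u using Finset.induction_on with
    | empty => simp
    | insert a u ha ih =>
      intro hu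
      have := finiteDimensional_singularSpace hK (hu a (Finset.mem_insert_self a u))
      rw [Finset.iSup_insert, Finset.sum_insert ha, Nat.cast_add]
      refine (Submodule.rank_add_le_rank_add_rank _ _).trans (add_le_add ?_ ?_)
      · exact (Module.finrank_eq_rank ℂ (singularSpace K a)).symm.le
      · exact ih fun s hs => hu s (Finset.mem_insert_of_mem hs)
  have hVrank := hfin t ht0
  have hVfin : FiniteDimensional ℂ V :=
    Module.rank_lt_aleph0_iff.1 (hVrank.trans_lt (Cardinal.natCast_lt_aleph0))
  have hV : ∀ s : ℝ, ε ≤ s → singularSpace K s ≤ V := by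
    intro s hs
    by_cases hst : s ∈ t
    · exact le_iSup₂_of_le s hst le_rfl
    · simp [ht s hs hst]
  have hVperp : ⨅ s ∈ t, (singularSpace K s)ᗮ = Vᗮ := by
    rw [show V = ⨆ s : t, singularSpace K (s : ℝ) from iSup_subtype', ← Submodule.iInf_orthogonal]
    exact iInf_subtype'
  have hinv : ∀ v ∈ Vᗮ, (ContinuousLinearMap.adjoint K * K : H →L[ℂ] H) v ∈ Vᗮ := by
    intro v hv
    rw [← hVperp] at hv ⊢
    simp only [Submodule.mem_iInf] at hv ⊢
    exact fun s hs =>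
      (isSymmetric_adjoint_mul_self K).invariant_orthogonalComplement_eigenspace _ v (hv s hs)
  refine ⟨K * V.starProjection, ?_, ?_⟩
  · refine ContinuousLinearMap.opNorm_le_bound _ hε.le fun x => ?_
    have hx : x - V.starProjection x ∈ Vᗮ := V.sub_starProjection_mem_orthogonal x
    have h1 := norm_apply_le_of_singularSpace_le hK hε hV hinv hx
    have h2 : ‖x - V.starProjection x‖ ≤ ‖x‖ := by
      rw [← Submodule.starProjection_orthogonal_val]
      exact Vᗮ.norm_starProjection_apply_le x
    calc ‖(K - K * V.starProjection) x‖ = ‖K (x - V.starProjection x)‖ := by simp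
      _ ≤ ε * ‖x‖ := h1.trans (by gcongr)
  · refine (LinearMap.rank_comp_le_right (V.starProjection : H →ₗ[ℂ] H) (K : H →ₗ[ℂ] H)).trans ?_
    refine le_trans (Submodule.rank_mono ?_) hVrank
    rintro _ ⟨x, rfl⟩
    exact V.starProjection_apply_mem x

/-- The number of singular values bounded below by `r` is at most the rank of any approximation
of the operator within `r / 2`. -/
theorem sum_singularMultiplicity_le {K : H →L[ℂ] H} (hK : IsCompactOperator K) {r : ℝ}
    (hr : 0 < r) {F : H →L[ℂ] H} {k : ℕ} (hF : ‖K - F‖ ≤ r / 2)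
    (hk : (F : H →ₗ[ℂ] H).rank ≤ (k : Cardinal)) (t : Finset ℝ) (ht : ∀ s ∈ t, r ≤ s) :
    ∑ s ∈ t, singularMultiplicity K s ≤ k := by
  have hpos : ∀ i : t, 0 < (i : ℝ) := fun i => hr.trans_le (ht i i.2)
  have hfin : ∀ i : t, FiniteDimensional ℂ (singularSpace K (i : ℝ)) := fun i =>
    finiteDimensional_singularSpace hK (hpos i)
  have horth := orthogonalFamily_singularSpace K (fun i : t => (i : ℝ)) hpos
    Subtype.val_injective
  let sumMap : (∀ i : t, singularSpace K (i : ℝ)) →ₗ[ℂ] H :=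
    ∑ i : t, (singularSpace K (i : ℝ)).subtype ∘ₗ LinearMap.proj i
  have h_sumMap : ∀ y, sumMap y = ∑ i : t, (y i : H) := fun y => by simp [sumMap]
  -- On the sum `x` of the singular vectors, `‖K x‖ ≥ r ‖x‖`, whereas `F x = 0` would give `‖K x‖ ≤
  -- (r / 2) ‖x‖`.
  have hinj : Function.Injective ((F : H →ₗ[ℂ] H) ∘ₗ sumMap) := by
    rw [← LinearMap.ker_eq_bot, LinearMap.ker_eq_bot']
    intro y hy
    have hF0 : F (sumMap y) = 0 := hy
    have hnorm : ‖sumMap y‖ ^ 2 = ∑ i : t, ‖y i‖ ^ 2 := by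
      rw [h_sumMap]; exact horth.norm_sum y Finset.univ
    have hKnorm : ‖K (sumMap y)‖ ^ 2 = ∑ i : t, (i : ℝ) ^ 2 * ‖y i‖ ^ 2 := by
      have h1 : (ContinuousLinearMap.adjoint K * K : H →L[ℂ] H) (sumMap y)
          = ∑ i : t, ((((i : ℂ) ^ 2) • y i : singularSpace K (i : ℝ)) : H) := by
        rw [h_sumMap, map_sum]
        exact Finset.sum_congr rfl fun i _ => mem_singularSpace.1 (y i).2
      have h2 := horth.inner_sum y (fun i => ((i : ℂ) ^ 2) • y i) Finset.univ
      have h3 := inner_adjoint_mul_self K (sumMap y)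
      rw [h1, h_sumMap] at h3
      have h4 : (∑ i : t, inner ℂ (y i) (((i : ℂ) ^ 2) • y i)) = (‖K (sumMap y)‖ : ℂ) ^ 2 := by
        rw [← h2, h_sumMap]; exact h3
      simp only [inner_smul_right, inner_self_eq_norm_sq_to_K] at h4
      apply Complex.ofReal_injective
      push_cast
      exact h4.symm
    have hlow : r ^ 2 * ‖sumMap y‖ ^ 2 ≤ ‖K (sumMap y)‖ ^ 2 := by
      rw [hnorm, hKnorm, Finset.mul_sum]
      gcongr with i
      exact ht i i.2
    have hup : ‖K (sumMap y)‖ ≤ r / 2 * ‖sumMap y‖ := by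
      have h1 : K (sumMap y) = (K - F) (sumMap y) := by simp [hF0]
      rw [h1]
      exact (K - F).le_of_opNorm_le hF _
    have hzero : ‖sumMap y‖ ^ 2 = 0 := by
      have h1 : ‖K (sumMap y)‖ ^ 2 ≤ (r / 2 * ‖sumMap y‖) ^ 2 := by gcongr
      have h2 : 0 < r ^ 2 := by positivity
      nlinarith [sq_nonneg ‖sumMap y‖]
    rw [hnorm, Finset.sum_eq_zero_iff_of_nonneg fun i _ => by positivity] at hzero
    funext i
    simpa using hzero i (Finset.mem_univ i)
  have hrank : Module.rank ℂ (∀ i : t, singularSpace K (i : ℝ)) ≤ (k : Cardinal) := by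
    refine (LinearEquiv.ofInjective _ hinj).rank_eq.le.trans ?_
    exact (LinearMap.rank_comp_le_left _ _).trans hk
  rw [← Module.finrank_eq_rank, Nat.cast_le, Module.finrank_pi_fintype] at hrank
  rw [← Finset.sum_coe_sort]
  exact hrank

end SingularSpaces

/-! ### Schatten norms versus finite-rank approximation. -/

section SchattenClass

variable {H : Type*} [NormedAddCommGroup H] [InnerProductSpace ℂ H] [CompleteSpace H]

/-- `finrank` also vanishes in infinite dimension; compactness excludes that case. -/
theorem singularSpace_eq_bot {K : H →L[ℂ] H} (hK : IsCompactOperator K) {s : ℝ} (hs : 0 < s)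
    (h : singularMultiplicity K s = 0) : singularSpace K s = ⊥ := by
  have := finiteDimensional_singularSpace hK hs
  exact Submodule.finrank_eq_zero.1 h

theorem isCompactOperator_of_schattenNorm_lt_top {p : ℝ} {K : H →L[ℂ] H}
    (h : schattenNorm p K < ⊤) : IsCompactOperator K := by
  by_contra hK
  simp [schattenNorm, hK] at h

/-- Chebyshev's inequality: each singular value at least `ε` contributes at least `ε ^ q` to a
finite sum. Truncating there gives the approximant. -/
theorem hasFiniteRankApprox_of_schattenNorm_lt_top {q : ℝ} (hq : 0 < q) {K : H →L[ℂ] H}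
    (h : schattenNorm q K < ⊤) : HasFiniteRankApprox q K := by
  have hK := isCompactOperator_of_schattenNorm_lt_top h
  rw [schattenNorm, if_pos hK, ENNReal.rpow_lt_top_iff_of_pos (by positivity)] at h
  set f : Set.Ioi (0 : ℝ) → ℝ≥0∞ := fun s =>
    (singularMultiplicity K s : ℝ≥0∞) * ENNReal.ofReal (s : ℝ) ^ q with hf
  refine ⟨(∑' s, f s).toReal, fun ε hε hε1 => ?_⟩
  have hε' : ENNReal.ofReal ε ^ q = ENNReal.ofReal (ε ^ q) := ENNReal.ofReal_rpow_of_pos hε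
  have hεq : 0 < ε ^ q := by positivity
  have hterm : ∀ s : Set.Ioi (0 : ℝ), ε ≤ s →
      (singularMultiplicity K s : ℝ≥0∞) * ENNReal.ofReal (ε ^ q) ≤ f s := by
    intro s hs
    rw [← hε']
    simp only [hf]
    gcongr
  have hfinite := ENNReal.finite_const_le_of_tsum_ne_top h.ne
    (ε := ENNReal.ofReal (ε ^ q)) (by simpa using hεq)
  let u : Finset (Set.Ioi (0 : ℝ)) := hfinite.toFinset.filter fun s => ε ≤ s
  obtain ⟨F, hF, hFk⟩ := exists_rank_le_norm_sub_le_of_singularSpace_eq_bot hK hε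
    (u.map (Function.Embedding.subtype _)) (by simp [u]) (by
      intro s hs hsu
      have hs0 : 0 < s := hε.trans_le hs
      refine singularSpace_eq_bot hK hs0 ?_
      by_contra hm
      refine hsu (Finset.mem_map.2 ⟨⟨s, hs0⟩, ?_, rfl⟩)
      simp only [u, Finset.mem_filter, Set.Finite.mem_toFinset, Set.mem_ofPred_eq]
      refine ⟨le_trans ?_ (hterm ⟨s, hs0⟩ hs), hs⟩
      refine le_mul_of_one_le_left (by simp) ?_
      exact_mod_cast Nat.one_le_iff_ne_zero.2 hm)
  refine ⟨F, hF, _, hFk, ?_⟩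
  have hsum : ((∑ s ∈ u.map (Function.Embedding.subtype _), singularMultiplicity K s : ℕ) : ℝ≥0∞)
      * ENNReal.ofReal (ε ^ q) ≤ ∑' s, f s := by
    rw [Finset.sum_map, Nat.cast_sum, Finset.sum_mul]
    refine le_trans (Finset.sum_le_sum fun s hs => hterm s ?_) (ENNReal.sum_le_tsum u)
    exact (Finset.mem_filter.1 hs).2
  have hreal := ENNReal.toReal_mono h.ne hsum
  rw [ENNReal.toReal_mul, ENNReal.toReal_natCast, ENNReal.toReal_ofReal hεq.le] at hreal
  rw [Real.rpow_neg hε.le, ← div_eq_mul_inv, le_div_iff₀ hεq]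
  exact hreal

/-- The operator norm is dominated by the Schatten norm. -/
theorem norm_le_of_schattenNorm_lt {q : ℝ} (hq : 0 < q) {K : H →L[ℂ] H} {ε : ℝ} (hε : 0 < ε)
    (h : schattenNorm q K < ENNReal.ofReal ε) : ‖K‖ ≤ ε := by
  have hK := isCompactOperator_of_schattenNorm_lt_top (h.trans ENNReal.ofReal_lt_top)
  rw [schattenNorm, if_pos hK, one_div, ENNReal.rpow_inv_lt_iff hq] at h
  -- A single singular value at least `ε` would already exceed the bound on the sum, so the
  -- truncation is over `∅` and has rank zero.
  obtain ⟨F, hF, hFk⟩ := exists_rank_le_norm_sub_le_of_singularSpace_eq_bot hK hε ∅ (by simp) (by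
      intro s hs _
      have hs0 : 0 < s := hε.trans_le hs
      refine singularSpace_eq_bot hK hs0 ?_
      by_contra hm
      refine h.not_ge (le_trans ?_ (ENNReal.le_tsum ⟨s, hs0⟩))
      calc ENNReal.ofReal ε ^ q ≤ ENNReal.ofReal s ^ q := by gcongr
        _ ≤ _ := le_mul_of_one_le_left (by simp) (by exact_mod_cast Nat.one_le_iff_ne_zero.2 hm))
  have hF0 : F = 0 := by
    have h1 : LinearMap.range (F : H →ₗ[ℂ] H) = ⊥ :=
      Submodule.rank_eq_zero.1 (le_antisymm (by simpa using hFk) zero_le)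
    have h2 := LinearMap.range_eq_bot.1 h1
    exact ContinuousLinearMap.coe_injective h2
  simpa [hF0] using hF

open MeasureTheory in
-- Layer cake: the sum of the singular values is the integral over `r` of the number of them at
-- least `r`. That number is `O(r ^ (-p) + 1)`, integrable near `0` because `p < 1`.
theorem HasFiniteRankApprox.mem_schattenClass_one {p : ℝ} (hp : p < 1)
    {K : H →L[ℂ] H} (hK : IsCompactOperator K) (h : HasFiniteRankApprox p K) :
    K ∈ schattenClass H 1 := by
  obtain ⟨C, hC⟩ := h
  have hC0 : 0 ≤ C := by
    obtain ⟨F, -, k, -, hk⟩ := hC 1 one_pos le_rfl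
    have := Nat.cast_nonneg (α := ℝ) k
    simp at hk
    linarith
  refine ⟨hK, ?_⟩
  rw [schattenNorm, if_pos hK]
  simp only [div_one, ENNReal.rpow_one]
  -- Since `‖K‖ ≤ M / 2`, the zero operator serves as approximant at level `M`, so no singular value
  -- reaches `M`.
  set M : ℝ := 2 * ‖K‖ + 1 with hM
  have hM0 : 0 < M := by positivity
  set g : ℝ → ℝ := fun r => C * ((2⁻¹ : ℝ) ^ (-p) * r ^ (-p) + 1) with hg
  have hgint : IntegrableOn g (Set.Ioc 0 M) := by
    have h1 : IntervalIntegrable (fun r : ℝ => r ^ (-p)) volume 0 M :=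
      intervalIntegral.intervalIntegrable_rpow' (by linarith)
    have h2 := ((h1.const_mul ((2⁻¹ : ℝ) ^ (-p))).add
      (intervalIntegrable_const (c := (1 : ℝ)))).const_mul C
    exact (intervalIntegrable_iff_integrableOn_Ioc_of_le hM0.le).1 h2
  have hcount : ∀ r ∈ Set.Ioc 0 M, ∀ t : Finset ℝ, (∀ s ∈ t, r ≤ s) →
      ((∑ s ∈ t, singularMultiplicity K s : ℕ) : ℝ≥0∞) ≤ ENNReal.ofReal (g r) := by
    intro r hr t ht
    have hr0 : 0 < r := hr.1
    -- Tolerances are capped at `1`; the summand `1` in `g` covers the case `r / 2 > 1`.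
    obtain ⟨F, hF, k, hFk, hk⟩ := hC (min (r / 2) 1) (by positivity) (min_le_right _ _)
    have h1 := sum_singularMultiplicity_le hK hr0 (hF.trans (min_le_left _ _)) hFk t ht
    rw [← ENNReal.ofReal_natCast]
    refine ENNReal.ofReal_le_ofReal ((Nat.cast_le.2 h1).trans (hk.trans ?_))
    simp only [hg]
    gcongr
    rcases min_cases (r / 2) 1 with ⟨h2, -⟩ | ⟨h2, -⟩
    · rw [h2, div_eq_inv_mul, Real.mul_rpow (by norm_num) hr0.le]
      linarith
    · rw [h2, Real.one_rpow]
      have : 0 ≤ (2⁻¹ : ℝ) ^ (-p) * r ^ (-p) := by positivity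
      linarith
  have hlarge : ∀ s, M ≤ s → singularMultiplicity K s = 0 := by
    intro s hs
    have h1 := sum_singularMultiplicity_le hK hM0 (F := 0) (k := 0)
      (by simp only [sub_zero, hM]; linarith) (by simp) {s} (by simpa using hs)
    simpa using h1
  refine lt_of_le_of_lt ?_ hgint.lintegral_lt_top
  rw [ENNReal.tsum_eq_iSup_sum]
  refine iSup_le fun t => ?_
  have hlayer : ∀ s : Set.Ioi (0 : ℝ),
      (singularMultiplicity K s : ℝ≥0∞) * ENNReal.ofReal (s : ℝ) =
        ∫⁻ r in Set.Ioc 0 M, (Set.Iic (s : ℝ)).indicator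
          (fun _ => (singularMultiplicity K s : ℝ≥0∞)) r := by
    intro s
    rw [lintegral_indicator measurableSet_Iic, setLIntegral_const,
      Measure.restrict_apply measurableSet_Iic]
    rcases le_total M s with hs | hs
    · simp [hlarge s hs]
    · rw [show Set.Iic (s : ℝ) ∩ Set.Ioc 0 M = Set.Ioc 0 (s : ℝ) by
        ext r; simp only [Set.mem_inter_iff, Set.mem_Iic, Set.mem_Ioc]
        exact ⟨fun h => ⟨h.2.1, h.1⟩, fun h => ⟨h.2, h.1, h.2.trans hs⟩⟩]
      simp
  simp_rw [hlayer]
  rw [← lintegral_finsetSum t fun s _ => measurable_const.indicator measurableSet_Iic]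
  refine setLIntegral_mono' measurableSet_Ioc fun r hr => ?_
  refine le_trans (le_of_eq ?_) (hcount r hr
    ((t.filter fun s : Set.Ioi (0 : ℝ) => r ≤ s).map (Function.Embedding.subtype _)) ?_)
  · rw [Finset.sum_map, Nat.cast_sum, Finset.sum_filter]
    exact Finset.sum_congr rfl fun s _ => by simp [Set.indicator_apply]
  · simp

end SchattenClass

/-! ### Resolvents, compactness and approximability of the semigroup. -/

section Semigroup

variable {H : Type*} [NormedAddCommGroup H] [InnerProductSpace ℂ H]

theorem IsResolventAt.isCompactOperator_of_isCompactOperator {A : H →ₗ.[ℂ] H} {z w : ℂ}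
    {R S : H →L[ℂ] H} (hR : IsResolventAt A z R) (hS : IsResolventAt A w S)
    (hRc : IsCompactOperator R) : IsCompactOperator S := by
  -- The first resolvent identity.
  have h : S = R + (w - z) • (S * R) := by
    ext y
    obtain ⟨hy, hAy⟩ := hR.1 y
    have h1 := hS.2 ⟨R y, hy⟩
    rw [sub_eq_iff_eq_add.1 hAy] at h1
    simp only [map_sub, map_add, map_smul] at h1
    have h2 : ((w - z) • (S * R)) y = w • S (R y) - z • S (R y) := sub_smul w z _
    rw [add_apply, h2]
    nth_rewrite 1 [← h1]
    abel
  rw [h]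
  exact hRc.add ((hRc.clm_comp S).smul (w - z))

variable {U : ℝ → H →L[ℂ] H}

theorem intervalIntegrable_of_continuousOn_Ioi (hU : ContinuousOn U (Set.Ioi 0)) {a b : ℝ}
    (ha : 0 < a) (hb : 0 < b) : IntervalIntegrable U MeasureTheory.volume a b :=
  (hU.mono fun _ hx => (lt_min ha hb).trans_le hx.1).intervalIntegrable

theorem IsC0Semigroup.map_nat_mul (hU : IsC0Semigroup U) (n : ℕ) {t : ℝ} (ht : 0 ≤ t) :
    U (n * t) = U t ^ n := by
  induction n with
  | zero => simp [hU.map_zero]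
  | succ n ih =>
    rw [Nat.cast_succ, add_mul, one_mul, hU.map_add _ _ (by positivity) ht, ih, pow_succ]

variable [CompleteSpace H]

theorem IsSchattenContinuous.continuousAt {q : ℝ} (hq : 0 < q)
    (hU : IsSchattenContinuous q U) {t : ℝ} (ht : 0 < t) : ContinuousAt U t := by
  rw [ContinuousAt, Metric.tendsto_nhds]
  intro ε hε
  have h := (hU t ht).eventually_lt_const
    (show (0 : ℝ≥0∞) < ENNReal.ofReal (ε / 2) by simpa using hε)
  filter_upwards [h] with τ hτ
  rw [dist_eq_norm]
  linarith [norm_le_of_schattenNorm_lt hq (half_pos hε) hτ]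

theorem tendsto_inv_smul_integral (hU : ContinuousOn U (Set.Ioi 0)) {t : ℝ} (ht : 0 < t) :
    Tendsto (fun h : ℝ => h⁻¹ • ∫ s in t..t + h, U s) (𝓝[>] 0) (𝓝 (U t)) := by
  have h := intervalIntegral.integral_hasDerivAt_right
    (intervalIntegrable_of_continuousOn_Ioi hU ht ht)
    (hU.stronglyMeasurableAtFilter isOpen_Ioi t ht)
    (hU.continuousAt (Ioi_mem_nhds ht))
  simpa using h.tendsto_slope_zero_right

/-- Applying `1 - U h` to the integral cancels all but two end pieces of length `h`; dividing by `h`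
shows that `A` maps the integral to `U t - U (t + e)`. Starting at `t > 0` keeps the integrand norm
continuous. -/
theorem IsC0Semigroup.integral_eq_resolvent_mul (hU : IsC0Semigroup U)
    (hc : ContinuousOn U (Set.Ioi 0)) {R : H →L[ℂ] H} (hR : IsResolventAt (generator U) 0 R)
    {t e : ℝ} (ht : 0 < t) (he : 0 < e) :
    ∫ s in t..t + e, U s = R * (U t - U (t + e)) := by
  have hint : ∀ {a b : ℝ}, 0 < a → 0 < b → IntervalIntegrable U MeasureTheory.volume a b :=
    fun ha hb => intervalIntegrable_of_continuousOn_Ioi hc ha hb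
  set V : H →L[ℂ] H := ∫ s in t..t + e, U s with hV
  have hshift : ∀ h : ℝ, 0 < h → V - U h * V =
      (∫ s in t..t + h, U s) - ∫ s in (t + e)..(t + e + h), U s := by
    intro h hh
    have h1 : U h * V = ∫ s in (t + h)..(t + e + h), U s := by
      rw [← intervalIntegral.integral_comp_add_right, hV]
      have h2 := (ContinuousLinearMap.mul ℝ (H →L[ℂ] H) (U h)).intervalIntegral_comp_comm
        (hint ht (add_pos ht he))
      simp only [ContinuousLinearMap.mul_apply'] at h2
      rw [← h2]
      refine intervalIntegral.integral_congr fun s hs => ?_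
      rw [Set.uIcc_of_le (by linarith)] at hs
      rw [add_comm s h, hU.map_add h s hh.le (by linarith [hs.1])]
    rw [h1, intervalIntegral.integral_interval_sub_interval_comm]
    all_goals apply hint <;> positivity
  have hlim : Tendsto (fun h : ℝ => h⁻¹ • (V - U h * V)) (𝓝[>] 0) (𝓝 (U t - U (t + e))) := by
    refine ((tendsto_inv_smul_integral hc ht).sub
      (tendsto_inv_smul_integral hc (add_pos ht he))).congr' ?_
    filter_upwards [self_mem_nhdsWithin] with h hh
    rw [hshift h hh, smul_sub]
  ext x
  have hgraph : (V x, (U t - U (t + e)) x) ∈ (generator U).graph := by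
    rw [mem_generator_graph_iff]
    have h1 := ((ContinuousLinearMap.apply ℂ H x).continuous.tendsto _).comp hlim
    refine h1.congr fun h => ?_
    simp [← Complex.ofReal_inv, Complex.coe_smul]
  obtain ⟨v, hv1, hv2⟩ := (LinearPMap.mem_graph_iff _).1 hgraph
  have h2 := hR.2 v
  simp only at hv1 hv2
  rw [zero_smul, sub_zero, hv2, hv1] at h2
  exact h2.symm

theorem IsC0Semigroup.isCompactOperator (hU : IsC0Semigroup U)
    (hc : ContinuousOn U (Set.Ioi 0)) {R : H →L[ℂ] H} (hR : IsResolventAt (generator U) 0 R)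
    (hRc : IsCompactOperator R) {t : ℝ} (ht : 0 < t) : IsCompactOperator (U t) := by
  refine isCompactOperator_of_tendsto (tendsto_inv_smul_integral hc ht) ?_
  filter_upwards [self_mem_nhdsWithin] with h hh
  rw [hU.integral_eq_resolvent_mul hc hR ht hh]
  exact (hRc.comp_clm (U t - U (t + h))).smul h⁻¹

theorem IsC0Semigroup.hasFiniteRankApprox (hU : IsC0Semigroup U) {q : ℝ} (hq : 0 < q)
    (hcont : IsSchattenContinuous q U) (hcomp : ∀ t, 0 < t → IsCompactOperator (U t))
    {t : ℝ} (ht : 0 < t) : HasFiniteRankApprox q (U t) := by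
  have h1 : ∀ᶠ e in 𝓝[>] (0 : ℝ), schattenNorm q (U (t + e) - U t) < ⊤ := by
    have h2 : Tendsto (fun e : ℝ => t + e) (𝓝[>] 0) (𝓝 t) := by
      have : Tendsto (fun e : ℝ => t + e) (𝓝 0) (𝓝 (t + 0)) :=
        (continuous_const.add continuous_id).tendsto 0
      rw [add_zero] at this
      exact this.mono_left nhdsWithin_le_nhds
    exact h2.eventually ((hcont t ht).eventually_lt_const ENNReal.zero_lt_top)
  obtain ⟨e, he, he0⟩ := (h1.and self_mem_nhdsWithin).exists
  obtain ⟨F, k, hk, hF⟩ := (hcomp e he0).exists_rank_le_norm_sub_le (one_half_pos (α := ℝ))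
  have hD := hasFiniteRankApprox_of_schattenNorm_lt_top hq he
  have hFin : HasFiniteRankApprox q (U t * F) := hasFiniteRankApprox_of_rank_le hq.le
    ((LinearMap.rank_comp_le_right (F : H →ₗ[ℂ] H) (U t : H →ₗ[ℂ] H)).trans hk)
  -- Invertible by the Neumann series, as `‖U e - F‖ ≤ 1/2`.
  let u : (H →L[ℂ] H)ˣ := Units.oneSub (U e - F) (by linarith)
  have hu : (u : H →L[ℂ] H) = 1 - (U e - F) := rfl
  have hprod : U t * F - (U (t + e) - U t) = U t * u := by
    rw [hU.map_add t e ht.le (le_of_lt he0), hu]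
    noncomm_ring
  have h3 := (hFin.sub hD).mul_right (↑u⁻¹ : H →L[ℂ] H)
  rwa [hprod, Units.mul_inv_cancel_right] at h3

end Semigroup
end GibbsSemigroup

theorem corollary5p16 {H : Type*} [NormedAddCommGroup H] [InnerProductSpace ℂ H]
    [CompleteSpace H] [TopologicalSpace.SeparableSpace H]
    (U : ℝ → H →L[ℂ] H) (hU : GibbsSemigroup.IsC0Semigroup U)
    (q : ℝ) (hq : 1 ≤ q) (hcont : GibbsSemigroup.IsSchattenContinuous q U)
    (h0 : (0 : ℂ) ∈ GibbsSemigroup.resolventSet (GibbsSemigroup.generator U))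
    (hres : ∃ z ∈ GibbsSemigroup.resolventSet (GibbsSemigroup.generator U),
      GibbsSemigroup.resolvent (GibbsSemigroup.generator U) z ∈
        GibbsSemigroup.schattenClass H q) :
    GibbsSemigroup.IsGibbsSemigroup U := by
  have hq0 : 0 < q := one_pos.trans_le hq
  obtain ⟨R, hR⟩ := h0
  obtain ⟨z, hz, hzc, -⟩ := hres
  have hRc : IsCompactOperator R :=
    (GibbsSemigroup.isResolventAt_resolvent hz).isCompactOperator_of_isCompactOperator hR hzc
  have hc : ContinuousOn U (Set.Ioi 0) := fun t ht =>
    (hcont.continuousAt hq0 ht).continuousWithinAt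
  have hcomp : ∀ t, 0 < t → IsCompactOperator (U t) := fun t ht =>
    hU.isCompactOperator hc hR hRc ht
  refine ⟨hU, fun t ht => ?_⟩
  obtain ⟨n, hn⟩ := exists_nat_gt q
  have hn0 : (0 : ℝ) < n := hq0.trans hn
  have hpow := (hU.hasFiniteRankApprox hq0 hcont hcomp (div_pos ht hn0)).pow
    (n := n) (by exact_mod_cast hn0.ne')
  rw [← hU.map_nat_mul n (div_pos ht hn0).le, mul_div_cancel₀ t hn0.ne'] at hpow
  exact hpow.mem_schattenClass_one ((div_lt_one hn0).2 hn) (hcomp t ht)
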